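/- **Setting.** Let $M$ be a set with a reflexive symmetric relation $\sim$ (not assumed transitive; $x\sim y$ is read "$x$ and $y$ are neighbours"), and put $\mathfrak M(x)=\{z\in M : z\sim x\}$. An *$n$-path* is a tuple $(x_0,\dots,x_n)$ of points of $M$ with $x_i\sim x_{i+1}$ for $0\le i<n$; it goes from $x_0$ to $x_n$. Assume that $M$ is *path connected*: any two points are joined by an $n$-path for some $n$. For a group $G$, a *$G$-valued 1-form* $\omega$ assigns an element $\omega(x,y)\in G$ to each pair $x\sim y$, with $\omega(x,x)=1$ and $\omega(y,x)=\omega(x,y)^{-1}$. It is *closed* if $\omega(x,y)\,\omega(y,z)=\omega(x,z)$ for all mutual neighbours $x,y,z$. Let $GL(M)$ be the groupoid with object set $M$ whose arrows $x\to y$ are the bijections $\mathfrak M(x)\to\mathfrak M(y)$ taking $x$ to $y$, composed from left to right. Assume that $(M,\sim)$ satisfies the following axiom of combinatorial differential geometry: for every $o\in M$, every closed 1-form $\omega$ on $M$ with values in the vertex group $GL(M)(o,o)$ and every $n$, the path integral $\omega(x_0,x_1)\,\omega(x_1,x_2)\cdots\omega(x_{n-1},x_n)$ of an $n$-path depends only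 on $x_0$ and $x_n$. An *affine connection* on $M$ is a ternary operation $[zxy]$, defined whenever $x\sim y$ and $x\sim z$, such that $[zxy]\sim y$, $[zxy]\sim z$, $[zxx]=z$, $[xxy]=y$ and $[[zxy]yx]=z$. It is *symmetric* if $[zxy]=[yxz]$. It is *flat* if the arrows $\nabla(x,y):\mathfrak M(x)\to\mathfrak M(y)$, $z\mapsto[zxy]$, of $GL(M)$ satisfy $\nabla(x,y)\nabla(y,z)=\nabla(x,z)$ for all mutual neighbours $x,y,z$. Let a symmetric and flat affine connection on $M$ be given. Two paths $(x,z_1,\dots,z_m)$ and $(x,y_1,\dots,y_n)$ with the same first point $x$ span a grid: $u_{0,0}=x$, $u_{i,0}=z_i$, $u_{0,j}=y_j$ and $u_{i+1,j+1}=[u_{i+1,j}\,u_{i,j}\,u_{i,j+1}]$. Its codomain is $u_{m,n}$. **Proposition (Cancellation law).** There is exactly one everywhere defined ternary operation on $M$ (the extended connection, again written $[zxy]$) such that, for all $x,y,z\in M$, the point $[zxy]$ is the codomain of the grid spanned by any path from $x$ to $z$ and any path from $x$ to $y$. For this operation and for all $o,x,y,z\in M$, $$[[xoy]oz]=[[xoy]y[yoz]]=[xo[yoz]].$$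 In particular the associative law $[[xoy]oz]=[xo[yoz]]$ holds. -/

import Mathlib

universe u v

/-- A set with a reflexive symmetric relation `x ∼ y`, read "`x` and `y` are (first order
infinitesimal) neighbours". Transitivity is not assumed. -/
class NeighbourSpace (M : Type u) where
  Nbr : M → M → Prop
  nbr_refl : ∀ x, Nbr x x
  nbr_symm : ∀ {x y}, Nbr x y → Nbr y x

infix:50 " ∼ " => NeighbourSpace.Nbr

open NeighbourSpace

/-- The (first order) monad of `x`: the set of neighbours of `x`. -/
def InfMonad {M : Type u} [NeighbourSpace M] (x : M) : Type u := {z : M // x ∼ z}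

/-- The point `x` as an element of its own monad. -/
def InfMonad.base {M : Type u} [NeighbourSpace M] (x : M) : InfMonad x := ⟨x, nbr_refl x⟩

/-- An `n`-path: an `(n+1)`-tuple of points in which consecutive points are neighbours. -/
structure NPath (M : Type u) [NeighbourSpace M] (n : ℕ) where
  pt : Fin (n + 1) → M
  step : ∀ i : Fin n, pt i.castSucc ∼ pt i.succ

/-- The first point of a path. -/
def NPath.dom {M : Type u} [NeighbourSpace M] {n : ℕ} (p : NPath M n) : M := p.pt 0

/-- The last point of a path. -/
def NPath.cod {M : Type u} [NeighbourSpace M] {n : ℕ} (p : NPath M n) : M := p.pt (Fin.last n)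

/-- Any two points are joined by an `n`-path for some `n`. -/
def PathConnected (M : Type u) [NeighbourSpace M] : Prop :=
  ∀ x y : M, ∃ (n : ℕ) (p : NPath M n), p.dom = x ∧ p.cod = y

/-! ### Group valued 1-forms -/

/-- A `G`-valued 1-form on `M`. -/
structure OneForm (M : Type u) [NeighbourSpace M] (G : Type v) [Group G] where
  val : (x y : M) → x ∼ y → G
  val_self : ∀ x, val x x (nbr_refl x) = 1
  val_symm : ∀ {x y} (h : x ∼ y), val y x (nbr_symm h) = (val x y h)⁻¹

/-- `ω` is closed: `ω(x,y) ω(y,z) = ω(x,z)` for mutual neighbours `x, y, z`. -/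
def OneForm.IsClosed {M : Type u} [NeighbourSpace M] {G : Type v} [Group G]
    (ω : OneForm M G) : Prop :=
  ∀ {x y z : M} (hxy : x ∼ y) (hyz : y ∼ z) (hxz : x ∼ z),
    ω.val x y hxy * ω.val y z hyz = ω.val x z hxz

/-- The path integral `ω(x₀,x₁) ω(x₁,x₂) ⋯ ω(xₙ₋₁,xₙ)`. -/
def OneForm.integral {M : Type u} [NeighbourSpace M] {G : Type v} [Group G]
    (ω : OneForm M G) {n : ℕ} (p : NPath M n) : G :=
  (List.ofFn fun i : Fin n => ω.val (p.pt i.castSucc) (p.pt i.succ) (p.step i)).prod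

/-- The axiom on the neighbour space `M` (with respect to the coefficient group `G`): the path
integral of a closed `G`-valued 1-form on `M` along `n`-paths depends only on the end points. -/
def QuadrangleAxiom (M : Type u) [NeighbourSpace M] (G : Type v) [Group G] : Prop :=
  ∀ ω : OneForm M G, ω.IsClosed → ∀ (n : ℕ) (p q : NPath M n),
    p.dom = q.dom → p.cod = q.cod → ω.integral p = ω.integral q

/-! ### The groupoid `GL(M)` -/

/-- An arrow `x → y` of the groupoid `GL(M)`: a bijection from the monad of `x` to the monad
of `y` which takes `x` to `y`. -/
@[ext]
structure GLArrow {M : Type u} [NeighbourSpace M] (x y : M) where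
  toEquiv : InfMonad x ≃ InfMonad y
  map_base : toEquiv (InfMonad.base x) = InfMonad.base y

/-- Identity arrows. -/
def GLArrow.id {M : Type u} [NeighbourSpace M] (x : M) : GLArrow x x := ⟨Equiv.refl _, rfl⟩

/-- Composition of arrows, from left to right. -/
def GLArrow.comp {M : Type u} [NeighbourSpace M] {x y z : M}
    (f : GLArrow x y) (g : GLArrow y z) : GLArrow x z :=
  ⟨f.toEquiv.trans g.toEquiv, by
    rw [Equiv.trans_apply, f.map_base, g.map_base]⟩

/-- Inverse arrows. -/
def GLArrow.inv {M : Type u} [NeighbourSpace M] {x y : M} (f : GLArrow x y) : GLArrow y x :=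
  ⟨f.toEquiv.symm, by rw [Equiv.symm_apply_eq, f.map_base]⟩

/-- The vertex group of `GL(M)` at `x`; the product is composition from left to right. -/
instance GLArrow.vertexGroup {M : Type u} [NeighbourSpace M] (x : M) : Group (GLArrow x x) where
  mul f g := f.comp g
  one := GLArrow.id x
  inv f := f.inv
  mul_assoc _ _ _ := rfl
  one_mul _ := rfl
  mul_one _ := rfl
  inv_mul_cancel f := GLArrow.ext (Equiv.symm_trans_self f.toEquiv)

/-! ### Affine connections -/

/-- An affine connection on `M`: a ternary operation `[z x y]`, here written `op z x y`, defined
when `z` and `y` are neighbours of `x`, subject to the book-keeping laws `[z x y] ∼ y` and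
`[z x y] ∼ z`, the unit laws `[z x x] = z` and `[x x y] = y`, and the inversion law
`[[z x y] y x] = z`. -/
structure AffineConnection (M : Type u) [NeighbourSpace M] where
  op : (z x y : M) → x ∼ z → x ∼ y → M
  op_nbr_right : ∀ (z x y : M) (hz : x ∼ z) (hy : x ∼ y), op z x y hz hy ∼ y
  op_nbr_left : ∀ (z x y : M) (hz : x ∼ z) (hy : x ∼ y), op z x y hz hy ∼ z
  op_unit_left : ∀ (z x : M) (hz : x ∼ z), op z x x hz (nbr_refl x) = z
  op_unit_right : ∀ (x y : M) (hy : x ∼ y), op x x y (nbr_refl x) hy = y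
  op_inversion : ∀ (z x y : M) (hz : x ∼ z) (hy : x ∼ y),
    op (op z x y hz hy) y x (nbr_symm (op_nbr_right z x y hz hy)) (nbr_symm hy) = z

namespace AffineConnection

/-- Symmetry (torsion freeness): `[z x y] = [y x z]`. -/
def IsSymmetric {M : Type u} [NeighbourSpace M] (L : AffineConnection M) : Prop :=
  ∀ (z x y : M) (hz : x ∼ z) (hy : x ∼ y), L.op z x y hz hy = L.op y x z hy hz

/-- The connection in the groupoid `GL(M)` given by an affine connection: for `x ∼ y`, the arrow
`x → y` is the bijection `z ↦ [z x y]` of monads. -/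
def transport {M : Type u} [NeighbourSpace M] (L : AffineConnection M) {x y : M}
    (h : x ∼ y) : GLArrow x y where
  toEquiv :=
    { toFun := fun z => ⟨L.op z.1 x y z.2 h, nbr_symm (L.op_nbr_right z.1 x y z.2 h)⟩
      invFun := fun w =>
        ⟨L.op w.1 y x w.2 (nbr_symm h), nbr_symm (L.op_nbr_right w.1 y x w.2 (nbr_symm h))⟩
      left_inv := fun z => Subtype.ext (L.op_inversion z.1 x y z.2 h)
      right_inv := fun w => Subtype.ext (L.op_inversion w.1 y x w.2 (nbr_symm h)) }
  map_base := Subtype.ext (L.op_unit_right x y h)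

/-- Flatness: the associated connection `∇` in `GL(M)` is curvature free, that is
`∇(x,y) ∇(y,z) = ∇(x,z)` for mutual neighbours `x, y, z`. -/
def IsFlat {M : Type u} [NeighbourSpace M] (L : AffineConnection M) : Prop :=
  ∀ {x y z : M} (hxy : x ∼ y) (hyz : y ∼ z) (hxz : x ∼ z),
    (L.transport hxy).comp (L.transport hyz) = L.transport hxz

/-- An `m × n` grid: points `u i j` with `u (i+1) (j+1) = [u (i+1) j, u i j, u i (j+1)]`, in which
horizontally or vertically adjacent points are neighbours. -/
structure Grid {M : Type u} [NeighbourSpace M] (L : AffineConnection M) (m n : ℕ) where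
  u : Fin (m + 1) → Fin (n + 1) → M
  vert : ∀ (i : Fin m) (j : Fin (n + 1)), u i.castSucc j ∼ u i.succ j
  horiz : ∀ (i : Fin (m + 1)) (j : Fin n), u i j.castSucc ∼ u i j.succ
  square : ∀ (i : Fin m) (j : Fin n),
    u i.succ j.succ = L.op (u i.succ j.castSucc) (u i.castSucc j.castSucc) (u i.castSucc j.succ)
      (vert i j.castSucc) (horiz i.castSucc j)

/-- The edge of a grid formed by the points `u i 0`. -/
def Grid.leftEdge {M : Type u} [NeighbourSpace M] {L : AffineConnection M} {m n : ℕ}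
    (g : L.Grid m n) : NPath M m := ⟨fun i => g.u i 0, fun i => g.vert i 0⟩

/-- The edge of a grid formed by the points `u 0 j`. -/
def Grid.topEdge {M : Type u} [NeighbourSpace M] {L : AffineConnection M} {m n : ℕ}
    (g : L.Grid m n) : NPath M n := ⟨fun j => g.u 0 j, fun j => g.horiz 0 j⟩

/-- The codomain of a grid. -/
def Grid.cod {M : Type u} [NeighbourSpace M] {L : AffineConnection M} {m n : ℕ}
    (g : L.Grid m n) : M := g.u (Fin.last m) (Fin.last n)

/-- The grid `g` is spanned by the paths `q` (from `x` to `z`) and `p` (from `x` to `y`). -/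
def Grid.SpannedBy {M : Type u} [NeighbourSpace M] {L : AffineConnection M} {m n : ℕ}
    (g : L.Grid m n) (q : NPath M m) (p : NPath M n) : Prop :=
  g.leftEdge = q ∧ g.topEdge = p

/-- The everywhere defined ternary operation `E z x y` is the extended (unrestricted) connection:
for every path `q` from `x` to `z` and every path `p` from `x` to `y`, there is a grid spanned by
`q` and `p`, and `E z x y` is its codomain. -/
def IsExtension {M : Type u} [NeighbourSpace M] (L : AffineConnection M)
    (E : M → M → M → M) : Prop :=
  ∀ (x y z : M) (m n : ℕ) (q : NPath M m) (p : NPath M n),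
    q.dom = x → q.cod = z → p.dom = x → p.cod = y →
      ∃ g : L.Grid m n, g.SpannedBy q p ∧ g.cod = E z x y

end AffineConnection

/-! After a choice of arrows from a base point, flatness says that the connection is a closed form
with values in a vertex group of `GL(M)`. The axiom gives it a primitive, so parallel transport `T`
is path independent (`exists_parallelTransport`).

In a grid, row `i + 1` is the neighbour `a (i + 1)` of `a i` carried along row `i`, so each entry is
determined by the entry above it and the left edge (`seqGrid_succ_left`). Hence the top path matters
only through its end point; by symmetry of the connection the grid can be transposed, and the same
holds for the left path. This gives the extended operation.

It satisfies `[z' x y] = T z [z x y] z'` for `z ∼ z'`. Both cancellation laws follow by induction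
along a path, as their two sides obey the same recursion. -/

/-! ### Paths as infinite sequences -/

section Paths

variable {M : Type u} [NeighbourSpace M]

/-- An infinite sequence of points in which consecutive points are neighbours. -/
def IsNbrSeq (a : ℕ → M) : Prop := ∀ i, a i ∼ a (i + 1)

/-- The extension of a path to an infinite sequence, constant from its last point on. -/
def NPath.seq {n : ℕ} (p : NPath M n) (k : ℕ) : M := p.pt ⟨min k n, by omega⟩

theorem NPath.seq_of_le {n : ℕ} (p : NPath M n) {k : ℕ} (hk : k ≤ n) :
    p.seq k = p.pt ⟨k, by omega⟩ := by
  simp only [NPath.seq, min_eq_left hk]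

theorem NPath.seq_zero {n : ℕ} (p : NPath M n) : p.seq 0 = p.dom :=
  p.seq_of_le (Nat.zero_le n)

theorem NPath.seq_last {n : ℕ} (p : NPath M n) : p.seq n = p.cod :=
  p.seq_of_le le_rfl

theorem NPath.isNbrSeq_seq {n : ℕ} (p : NPath M n) : IsNbrSeq p.seq := by
  intro i
  rcases lt_or_ge i n with h | h
  · rw [p.seq_of_le h.le, p.seq_of_le h]
    exact p.step ⟨i, h⟩
  · simp only [NPath.seq, min_eq_right h, min_eq_right (h.trans (Nat.le_succ i))]
    exact nbr_refl _

/-- The first `n` steps of a sequence of neighbours. -/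
def IsNbrSeq.toNPath {a : ℕ → M} (ha : IsNbrSeq a) (n : ℕ) : NPath M n :=
  ⟨fun i => a i, fun i => ha i⟩

/-- Eventually constant sequences can be cut at any later index, so paths of different lengths
become comparable. -/
theorem PathConnected.exists_seq (h : PathConnected M) (x y : M) :
    ∃ (a : ℕ → M) (n : ℕ), IsNbrSeq a ∧ a 0 = x ∧ ∀ k, n ≤ k → a k = y := by
  obtain ⟨n, p, hx, hy⟩ := h x y
  refine ⟨p.seq, n, p.isNbrSeq_seq, p.seq_zero.trans hx, fun k hk => ?_⟩
  rw [← hy, ← p.seq_last]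
  simp only [NPath.seq, min_eq_right hk, min_self]

theorem PathConnected.induction (h : PathConnected M) {P : M → Prop} (x : M) (hx : P x)
    (step : ∀ y z, y ∼ z → P y → P z) (y : M) : P y := by
  obtain ⟨a, n, ha, h0, hn⟩ := h.exists_seq x y
  rw [← hn n le_rfl]
  clear hn
  induction n with
  | zero => rwa [h0]
  | succ n ih => exact step _ _ (ha n) ih

theorem IsNbrSeq.exists_extend {a : ℕ → M} (ha : IsNbrSeq a) (n : ℕ) {z : M} (hz : a n ∼ z) :
    ∃ b : ℕ → M, IsNbrSeq b ∧ (∀ k ≤ n, b k = a k) ∧ ∀ k, n + 1 ≤ k → b k = z := by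
  refine ⟨fun k => if k ≤ n then a k else z, fun i => ?_, fun k hk => if_pos hk,
    fun k hk => if_neg (by omega)⟩
  dsimp only
  rcases lt_trichotomy i n with h | rfl | h
  · rw [if_pos h.le, if_pos (Nat.succ_le_of_lt h)]
    exact ha i
  · rwa [if_pos le_rfl, if_neg (by omega)]
  · rw [if_neg (by omega), if_neg (by omega)]
    exact nbr_refl z

end Paths

/-! ### Primitives of closed forms -/

section Primitive

variable {M : Type u} [NeighbourSpace M] {G : Type v} [Group G]

theorem OneForm.val_eq_one (ω : OneForm M G) {x y : M} (h : x ∼ y) (hxy : x = y) :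
    ω.val x y h = 1 := by
  subst hxy
  exact ω.val_self x

theorem OneForm.val_congr (ω : OneForm M G) {x y x' y' : M} (h : x ∼ y) (h' : x' ∼ y')
    (hx : x = x') (hy : y = y') : ω.val x y h = ω.val x' y' h' := by
  subst hx hy
  rfl

theorem OneForm.integral_toNPath_succ (ω : OneForm M G) {a : ℕ → M}
    (ha : IsNbrSeq a) (n : ℕ) :
    ω.integral (ha.toNPath (n + 1)) =
      ω.integral (ha.toNPath n) * ω.val (a n) (a (n + 1)) (ha n) := by
  unfold OneForm.integral
  rw [List.ofFn_succ', List.concat_eq_append, List.prod_append, List.prod_singleton]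
  rfl

theorem OneForm.integral_toNPath_of_const (ω : OneForm M G) {a : ℕ → M} (ha : IsNbrSeq a)
    {n : ℕ} {y : M} (hn : ∀ k, n ≤ k → a k = y) {m : ℕ} (hm : n ≤ m) :
    ω.integral (ha.toNPath m) = ω.integral (ha.toNPath n) := by
  induction m, hm using Nat.le_induction with
  | base => rfl
  | succ m hm ih =>
    rw [ω.integral_toNPath_succ, ih, ω.val_eq_one (ha m), mul_one]
    rw [hn _ hm, hn _ (hm.trans (Nat.le_succ m))]

theorem OneForm.integral_toNPath_congr (ω : OneForm M G) {a b : ℕ → M} (ha : IsNbrSeq a)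
    (hb : IsNbrSeq b) {n : ℕ} (h : ∀ k ≤ n, b k = a k) :
    ω.integral (hb.toNPath n) = ω.integral (ha.toNPath n) := by
  have : hb.toNPath n = ha.toNPath n := by
    unfold IsNbrSeq.toNPath
    congr 1
    funext i
    exact h i (by omega)
  rw [this]

/-- A form with path independent integrals has a primitive. -/
theorem OneForm.exists_primitive (hM : QuadrangleAxiom M G)
    (hconn : PathConnected M) (o : M) (ω : OneForm M G) (hω : ω.IsClosed) :
    ∃ g : M → G, ∀ x y (h : x ∼ y), g y = g x * ω.val x y h := by
  choose a n ha h0 hn using hconn.exists_seq o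
  refine ⟨fun x => ω.integral ((ha x).toNPath (n x)), fun x y h => ?_⟩
  have hx : a x (n x) = x := hn x _ le_rfl
  obtain ⟨b, hb, hba, hby⟩ := (ha x).exists_extend (n x) (z := y) (by rwa [hx])
  have key : ω.integral ((ha y).toNPath (n y)) = ω.integral (hb.toNPath (n x + 1)) := by
    -- The axiom compares only paths of equal length; both are padded by constant steps, on which
    -- the form is `1`.
    rw [← ω.integral_toNPath_of_const (ha y) (hn y) (le_max_left (n y) (n x + 1)),
      ← ω.integral_toNPath_of_const hb hby (le_max_right (n y) (n x + 1))]
    refine hM ω hω _ _ _ ?_ ?_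
    · exact (h0 y).trans ((hba 0 (Nat.zero_le _)).trans (h0 x)).symm
    · exact (hn y _ (le_max_left _ _)).trans (hby _ (le_max_right _ _)).symm
  dsimp only
  rw [key, ω.integral_toNPath_succ, ω.integral_toNPath_congr (ha x) hb hba,
    ω.val_congr (hb (n x)) h ((hba _ le_rfl).trans hx) (hby _ le_rfl)]

end Primitive

/-! ### Cancellation in the groupoid -/

section Arrows

variable {M : Type u} [NeighbourSpace M]

theorem GLArrow.comp_inv_self {x y : M} (f : GLArrow x y) : f.comp f.inv = GLArrow.id x :=
  GLArrow.ext (Equiv.self_trans_symm f.toEquiv)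

theorem GLArrow.inv_comp_self {x y : M} (f : GLArrow x y) : f.inv.comp f = GLArrow.id y :=
  GLArrow.ext (Equiv.symm_trans_self f.toEquiv)

theorem GLArrow.inv_comp_cancel {x y z : M} (f : GLArrow y x) (g : GLArrow x z) :
    f.inv.comp (f.comp g) = g :=
  GLArrow.ext (Equiv.ext fun w => by simp [GLArrow.comp, GLArrow.inv])

end Arrows

namespace AffineConnection

/-! ### Path independent parallel transport -/

section ParallelTransport

variable {M : Type u} [NeighbourSpace M] (L : AffineConnection M)

theorem nonempty_glArrow (L : AffineConnection M) (hconn : PathConnected M) (o x : M) :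
    Nonempty (GLArrow o x) :=
  hconn.induction (P := fun x => Nonempty (GLArrow o x)) o ⟨GLArrow.id o⟩
    (fun _ _ h ⟨f⟩ => ⟨f.comp (L.transport h)⟩) x

theorem transport_nbr_symm {x y : M} (h : x ∼ y) :
    L.transport (nbr_symm h) = (L.transport h).inv :=
  GLArrow.ext (Equiv.ext fun _ => rfl)

/-- The closed form with values in a vertex group which corresponds to a flat connection under a
choice of arrows from `o` to all points. -/
def connectionForm {o : M} (s : ∀ x, GLArrow o x) :
    OneForm M (GLArrow o o) where
  val x y h := ((s x).comp (L.transport h)).comp (s y).inv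
  val_self x := by
    have h : L.transport (nbr_refl x) = GLArrow.id x :=
      GLArrow.ext (Equiv.ext fun z => Subtype.ext (L.op_unit_left z.1 x z.2))
    rw [h]
    exact GLArrow.comp_inv_self (s x)
  val_symm {x y} h := by
    rw [L.transport_nbr_symm]
    rfl

theorem connectionForm_isClosed (hflat : L.IsFlat) {o : M} (s : ∀ x, GLArrow o x) :
    (L.connectionForm s).IsClosed := by
  intro x y z hxy hyz hxz
  change (((s x).comp (L.transport hxy)).comp (s y).inv).comp
    (((s y).comp (L.transport hyz)).comp (s z).inv) = ((s x).comp (L.transport hxz)).comp (s z).inv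
  rw [← hflat hxy hyz hxz]
  exact congrArg (fun f => ((s x).comp (L.transport hxy)).comp f)
    (GLArrow.inv_comp_cancel (s y) ((L.transport hyz).comp (s z).inv))

/-- A flat connection is integrated by a family of arrows out of one point. -/
theorem exists_frame (hM : ∀ o : M, QuadrangleAxiom M (GLArrow o o)) (hconn : PathConnected M)
    (hflat : L.IsFlat) (o : M) :
    ∃ A : ∀ x, GLArrow o x, ∀ x y (h : x ∼ y), A y = (A x).comp (L.transport h) := by
  let s : ∀ x, GLArrow o x := fun x => (L.nonempty_glArrow hconn o x).some
  obtain ⟨g, hg⟩ := (L.connectionForm s).exists_primitive (hM o) hconn o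
    (L.connectionForm_isClosed hflat s)
  -- Since `ω(x,y) = s(x) ∇(x,y) s(y)⁻¹`, multiplying `g(y) = g(x) ω(x,y)` by `s(y)` removes the
  -- arbitrary choice of `s(y)`.
  refine ⟨fun x => GLArrow.comp (g x) (s x), fun x y h => ?_⟩
  dsimp only
  rw [hg x y h]
  change ((g x).comp (((s x).comp (L.transport h)).comp (s y).inv)).comp (s y) = _
  exact congrArg (fun f => ((g x).comp ((s x).comp (L.transport h))).comp f)
    (GLArrow.inv_comp_self (s y))

open Classical in
/-- The operation of an affine connection with the value `x` outside its domain. -/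
noncomputable def opTotal (z x y : M) : M :=
  if h : x ∼ z ∧ x ∼ y then L.op z x y h.1 h.2 else x

theorem opTotal_of_nbr {z x y : M} (hz : x ∼ z) (hy : x ∼ y) :
    L.opTotal z x y = L.op z x y hz hy :=
  dif_pos ⟨hz, hy⟩

/-- The default value `x` is unaffected by exchanging `z` and `y`, so symmetry needs no neighbour
hypotheses. -/
theorem opTotal_comm (hsymm : L.IsSymmetric) (z x y : M) :
    L.opTotal z x y = L.opTotal y x z := by
  by_cases h : x ∼ z ∧ x ∼ y
  · rw [L.opTotal_of_nbr h.1 h.2, L.opTotal_of_nbr h.2 h.1, hsymm]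
  · rw [opTotal, dif_neg h, opTotal, dif_neg (fun h' => h h'.symm)]

/-- The path independent parallel transport of a flat connection: `T x y z` is `z ∼ x` carried
to the monad of `y`. -/
theorem exists_parallelTransport (hM : ∀ o : M, QuadrangleAxiom M (GLArrow o o))
    (hconn : PathConnected M) (hflat : L.IsFlat) :
    ∃ T : M → M → M → M, ∀ x z, x ∼ z → T x x z = z ∧
      ∀ y y', y ∼ y' → L.opTotal (T x y z) y y' = T x y' z := by
  classical
  rcases isEmpty_or_nonempty M with hM' | ⟨⟨o⟩⟩
  · exact ⟨fun x _ _ => x, fun x => isEmptyElim x⟩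
  obtain ⟨A, hA⟩ := L.exists_frame hM hconn hflat o
  -- Transport from `x` to `y` goes back to `o` and out again. The default `z` in `T` is harmless,
  -- as every claim assumes `x ∼ z`.
  let S (x y : M) (z : InfMonad x) : InfMonad y := (A y).toEquiv ((A x).toEquiv.symm z)
  let T (x y z : M) : M := if h : x ∼ z then (S x y ⟨z, h⟩).1 else z
  have hTS : ∀ x y z (h : x ∼ z), T x y z = (S x y ⟨z, h⟩).1 := fun x y z h => dif_pos h
  refine ⟨T, fun x z hz => ⟨?_, fun y y' hy => ?_⟩⟩
  · rw [hTS x x z hz]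
    exact congrArg Subtype.val ((A x).toEquiv.apply_symm_apply ⟨z, hz⟩)
  · have hS : S x y' ⟨z, hz⟩ = (L.transport hy).toEquiv (S x y ⟨z, hz⟩) := by
      simp only [S, hA y y' hy]
      rfl
    rw [hTS x y z hz, hTS x y' z hz, hS, L.opTotal_of_nbr (S x y ⟨z, hz⟩).2 hy]
    rfl

end ParallelTransport

/-! ### Grids and their dependence on end points -/

section Grids

variable {M : Type u} [NeighbourSpace M] (L : AffineConnection M)

/-- The infinite grid spanned by two sequences of neighbours. -/
noncomputable def seqGrid (a b : ℕ → M) : ℕ → ℕ → M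
  | 0, j => b j
  | i + 1, 0 => a (i + 1)
  | i + 1, j + 1 =>
    L.opTotal (seqGrid a b (i + 1) j) (seqGrid a b i j) (seqGrid a b i (j + 1))

variable {a b a' b' : ℕ → M}

theorem seqGrid_zero_left (j : ℕ) : L.seqGrid a b 0 j = b j := by
  rw [seqGrid]

theorem seqGrid_zero_right (h0 : a 0 = b 0) (i : ℕ) : L.seqGrid a b i 0 = a i := by
  cases i with
  | zero => rw [seqGrid, h0]
  | succ i => rw [seqGrid]

theorem seqGrid_succ_succ (i j : ℕ) : L.seqGrid a b (i + 1) (j + 1) =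
    L.opTotal (L.seqGrid a b (i + 1) j) (L.seqGrid a b i j) (L.seqGrid a b i (j + 1)) := by
  rw [seqGrid]

/-- The law `[z x y] ∼ y` propagates vertical adjacency along a row, and `[z x y] ∼ z` then gives
horizontal adjacency in the next row. So no square uses the default value of `opTotal`. -/
theorem seqGrid_nbr (ha : IsNbrSeq a) (hb : IsNbrSeq b) (h0 : a 0 = b 0) (i j : ℕ) :
    L.seqGrid a b i j ∼ L.seqGrid a b (i + 1) j ∧
      L.seqGrid a b i j ∼ L.seqGrid a b i (j + 1) := by
  have vert : ∀ i, (∀ j, L.seqGrid a b i j ∼ L.seqGrid a b i (j + 1)) →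
      ∀ j, L.seqGrid a b i j ∼ L.seqGrid a b (i + 1) j := by
    intro i hi j
    induction j with
    | zero =>
      rw [L.seqGrid_zero_right h0, L.seqGrid_zero_right h0]
      exact ha i
    | succ j ih =>
      rw [seqGrid_succ_succ, L.opTotal_of_nbr ih (hi j)]
      exact nbr_symm (L.op_nbr_right _ _ _ _ _)
  have horiz : ∀ j, L.seqGrid a b i j ∼ L.seqGrid a b i (j + 1) := by
    induction i with
    | zero =>
      intro j
      rw [seqGrid_zero_left, seqGrid_zero_left]
      exact hb j
    | succ i ih =>
      intro j
      rw [seqGrid_succ_succ, L.opTotal_of_nbr (vert i ih j) (ih j)]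
      exact nbr_symm (L.op_nbr_left _ _ _ _ _)
  exact ⟨vert i horiz j, horiz j⟩

theorem seqGrid_transpose (hsymm : L.IsSymmetric) (h0 : a 0 = b 0) (i j : ℕ) :
    L.seqGrid a b i j = L.seqGrid b a j i := by
  induction i generalizing j with
  | zero => rw [seqGrid_zero_left, L.seqGrid_zero_right h0.symm]
  | succ i ih =>
    induction j with
    | zero => rw [seqGrid_zero_left, L.seqGrid_zero_right h0]
    | succ j ihj =>
      rw [seqGrid_succ_succ, seqGrid_succ_succ, ihj, ih, ih, L.opTotal_comm hsymm]

/-- Each square transports the vertical neighbour one step along row `i`; path independence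
collapses these steps into one `T`. -/
theorem seqGrid_succ_left {T : M → M → M → M}
    (hT : ∀ x z, x ∼ z → T x x z = z ∧ ∀ y y', y ∼ y' → L.opTotal (T x y z) y y' = T x y' z)
    (ha : IsNbrSeq a) (hb : IsNbrSeq b) (h0 : a 0 = b 0) (i j : ℕ) :
    L.seqGrid a b (i + 1) j = T (a i) (L.seqGrid a b i j) (a (i + 1)) := by
  induction j with
  | zero =>
    rw [L.seqGrid_zero_right h0, L.seqGrid_zero_right h0, (hT _ _ (ha i)).1]
  | succ j ih =>
    rw [seqGrid_succ_succ, ih, (hT _ _ (ha i)).2 _ _ (L.seqGrid_nbr ha hb h0 i j).2]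

/-- The recursion down a column involves only `a` and the current entry, so it sees the top path
through its starting value alone. -/
theorem seqGrid_congr_right {T : M → M → M → M}
    (hT : ∀ x z, x ∼ z → T x x z = z ∧ ∀ y y', y ∼ y' → L.opTotal (T x y z) y y' = T x y' z)
    (ha : IsNbrSeq a) (hb : IsNbrSeq b) (hb' : IsNbrSeq b')
    (h0 : a 0 = b 0) (h0' : a 0 = b' 0) {j j' : ℕ} (h : b j = b' j') (i : ℕ) :
    L.seqGrid a b i j = L.seqGrid a b' i j' := by
  induction i with
  | zero => rwa [seqGrid_zero_left, seqGrid_zero_left]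
  | succ i ih =>
    rw [L.seqGrid_succ_left hT ha hb h0, L.seqGrid_succ_left hT ha hb' h0', ih]

theorem seqGrid_congr {T : M → M → M → M}
    (hT : ∀ x z, x ∼ z → T x x z = z ∧ ∀ y y', y ∼ y' → L.opTotal (T x y z) y y' = T x y' z)
    (hsymm : L.IsSymmetric) (ha : IsNbrSeq a) (hb : IsNbrSeq b)
    (ha' : IsNbrSeq a') (hb' : IsNbrSeq b') (h0 : a 0 = b 0) (h0' : a' 0 = b' 0)
    (h : a 0 = a' 0) {i i' j j' : ℕ} (hi : a i = a' i') (hj : b j = b' j') :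
    L.seqGrid a b i j = L.seqGrid a' b' i' j' := by
  have h1 : a 0 = b' 0 := h.trans h0'
  rw [L.seqGrid_congr_right hT ha hb hb' h0 h1 hj, L.seqGrid_transpose hsymm h1,
    L.seqGrid_congr_right hT hb' ha ha' h1.symm h0'.symm hi, L.seqGrid_transpose hsymm h0'.symm]

/-- The grid spanned by two paths. -/
theorem exists_grid_spannedBy {m n : ℕ} (q : NPath M m) (p : NPath M n) (h : q.dom = p.dom) :
    ∃ g : L.Grid m n, g.SpannedBy q p ∧ g.cod = L.seqGrid q.seq p.seq m n := by
  have h0 : q.seq 0 = p.seq 0 := by rwa [q.seq_zero, p.seq_zero]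
  have hnbr := L.seqGrid_nbr q.isNbrSeq_seq p.isNbrSeq_seq h0
  refine ⟨⟨fun i j => L.seqGrid q.seq p.seq i j, fun i j => (hnbr i j).1, fun i j => (hnbr i j).2,
    fun i j => (L.seqGrid_succ_succ _ _).trans (L.opTotal_of_nbr _ _)⟩, ⟨?_, ?_⟩, rfl⟩
  · obtain ⟨q, hq⟩ := q
    unfold Grid.leftEdge
    congr 1
    funext i
    exact (L.seqGrid_zero_right h0 _).trans (NPath.seq_of_le _ (by omega))
  · obtain ⟨p, hp⟩ := p
    unfold Grid.topEdge
    congr 1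
    funext j
    exact (L.seqGrid_zero_left _).trans (NPath.seq_of_le _ (by omega))

/-- The square equations determine a grid from its two edges; this is what makes the extension
unique. -/
theorem Grid.SpannedBy.cod_eq {L : AffineConnection M} {m n : ℕ} {g : L.Grid m n} {q : NPath M m}
    {p : NPath M n} (hg : g.SpannedBy q p) : g.cod = L.seqGrid q.seq p.seq m n := by
  obtain ⟨rfl, rfl⟩ := hg
  have key : ∀ (i j : ℕ) (hi : i < m + 1) (hj : j < n + 1),
      g.u ⟨i, hi⟩ ⟨j, hj⟩ = L.seqGrid g.leftEdge.seq g.topEdge.seq i j := by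
    intro i
    induction i with
    | zero =>
      intro j hi hj
      rw [seqGrid_zero_left, NPath.seq_of_le _ (by omega)]
      rfl
    | succ i ih =>
      intro j hi hj
      induction j with
      | zero =>
        rw [L.seqGrid_zero_right (by rw [NPath.seq_zero, NPath.seq_zero]; rfl),
          NPath.seq_of_le _ (by omega)]
        rfl
      | succ j ihj =>
        rw [seqGrid_succ_succ, ← ihj (by omega), ← ih j (by omega) (by omega),
          ← ih (j + 1) (by omega) hj]
        have hs := g.square ⟨i, by omega⟩ ⟨j, by omega⟩
        exact hs.trans (L.opTotal_of_nbr (g.vert ⟨i, by omega⟩ ⟨j, by omega⟩)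
          (g.horiz ⟨i, by omega⟩ ⟨j, by omega⟩)).symm
  exact key m n _ _

end Grids

/-! ### The extended connection and its cancellation laws -/

section Extension

variable {M : Type u} [NeighbourSpace M] (L : AffineConnection M)

/-- The codomain of the grid spanned by sequences through `z` and `y` depends on the end points
only. -/
theorem exists_seqGrid_eq (hconn : PathConnected M) (hsymm : L.IsSymmetric) {T : M → M → M → M}
    (hT : ∀ x z, x ∼ z → T x x z = z ∧ ∀ y y', y ∼ y' → L.opTotal (T x y z) y y' = T x y' z) :
    ∃ E : M → M → M → M, ∀ a b : ℕ → M, IsNbrSeq a → IsNbrSeq b → a 0 = b 0 →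
      ∀ i j, L.seqGrid a b i j = E (a i) (a 0) (b j) := by
  choose c n hc c0 cn using hconn.exists_seq
  refine ⟨fun z x y => L.seqGrid (c x z) (c x y) (n x z) (n x y), fun a b ha hb h0 i j => ?_⟩
  exact L.seqGrid_congr hT hsymm ha hb (hc _ _) (hc _ _) h0 ((c0 _ _).trans (c0 _ _).symm)
    (c0 _ _).symm (cn _ _ _ le_rfl).symm (cn _ _ _ le_rfl).symm

theorem isExtension_iff {E : M → M → M → M} (hconn : PathConnected M)
    (hE : ∀ a b : ℕ → M, IsNbrSeq a → IsNbrSeq b → a 0 = b 0 →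
      ∀ i j, L.seqGrid a b i j = E (a i) (a 0) (b j)) (E' : M → M → M → M) :
    L.IsExtension E' ↔ E' = E := by
  have hcod : ∀ {m n : ℕ} (q : NPath M m) (p : NPath M n), q.dom = p.dom →
      L.seqGrid q.seq p.seq m n = E q.cod q.dom p.cod := by
    intro m n q p h
    rw [hE _ _ q.isNbrSeq_seq p.isNbrSeq_seq (by rwa [q.seq_zero, p.seq_zero]), q.seq_last,
      p.seq_last, q.seq_zero]
  constructor
  · intro h
    funext z x y
    obtain ⟨m, q, rfl, rfl⟩ := hconn x z
    obtain ⟨n, p, hp, rfl⟩ := hconn q.dom y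
    obtain ⟨g, hg, hgE⟩ := h _ _ _ m n q p rfl rfl hp rfl
    rw [← hgE, hg.cod_eq, hcod q p hp.symm]
  · rintro rfl x y z m n q p rfl rfl hp rfl
    obtain ⟨g, hg, hgc⟩ := L.exists_grid_spannedBy q p hp.symm
    exact ⟨g, hg, hgc.trans (hcod q p hp.symm)⟩

/-- The cancellation laws for the operation computed by grids. -/
theorem cancellation (hconn : PathConnected M) (hsymm : L.IsSymmetric) {T : M → M → M → M}
    (hT : ∀ x z, x ∼ z → T x x z = z ∧ ∀ y y', y ∼ y' → L.opTotal (T x y z) y y' = T x y' z)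
    {E : M → M → M → M}
    (hE : ∀ a b : ℕ → M, IsNbrSeq a → IsNbrSeq b → a 0 = b 0 →
      ∀ i j, L.seqGrid a b i j = E (a i) (a 0) (b j)) :
    (∀ o y w z, E w y (E y o z) = E w o z) ∧ ∀ o x y t, E (E x o y) y t = E x o t := by
  have unit : ∀ x y, E x x y = y := by
    intro x y
    obtain ⟨b, n, hb, rfl, hn⟩ := hconn.exists_seq x y
    rw [← hn n le_rfl, ← hE b b hb hb rfl 0 n, seqGrid_zero_left]
  have comm : ∀ z x y, E z x y = E y x z := by
    intro z x y
    obtain ⟨a, m, ha, rfl, hm⟩ := hconn.exists_seq x z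
    obtain ⟨b, n, hb, hb0, hn⟩ := hconn.exists_seq (a 0) y
    rw [← hm m le_rfl, ← hn n le_rfl, ← hE a b ha hb hb0.symm,
      L.seqGrid_transpose hsymm hb0.symm, hE b a hb ha hb0, hb0]
  -- Appending `z'` to a path from `x` to `z` adds one row to the grid.
  have step : ∀ x y z z', z ∼ z' → E z' x y = T z (E z x y) z' := by
    intro x y z z' hz
    obtain ⟨c, m, hc, c0, hm⟩ := hconn.exists_seq x z
    obtain ⟨a, ha, hac, haz⟩ := hc.exists_extend m (z := z') (by rwa [hm m le_rfl])
    obtain ⟨b, n, hb, hb0, hn⟩ := hconn.exists_seq x y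
    have a0 : a 0 = x := (hac 0 (Nat.zero_le m)).trans c0
    have am : a m = z := (hac m le_rfl).trans (hm m le_rfl)
    have h := L.seqGrid_succ_left hT ha hb (a0.trans hb0.symm) m n
    rwa [hE a b ha hb (a0.trans hb0.symm), hE a b ha hb (a0.trans hb0.symm), haz _ le_rfl,
      hn n le_rfl, a0, am] at h
  constructor
  -- Moving `w` to a neighbour applies the same transport to both sides; at `w = y` the unit law
  -- applies.
  · intro o y w z
    refine hconn.induction (P := fun w => E w y (E y o z) = E w o z) y (unit _ _)
      (fun w w' hw ih => ?_) w
    rw [step _ _ w w' hw, ih, ← step _ _ w w' hw]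
  · intro o x y t
    refine hconn.induction (P := fun t => E (E x o y) y t = E x o t) y ?_ (fun t t' ht ih => ?_) t
    · rw [comm, unit]
    -- The recursion is available in the first argument only, so `t` is moved there and back by
    -- commutativity.
    · rw [comm, step _ _ t t' ht, comm t, ih, comm x, ← step _ _ t t' ht, comm]

end Extension

end AffineConnection

theorem proposition3p5 {M : Type u} [NeighbourSpace M]
    (hM : ∀ o : M, QuadrangleAxiom M (GLArrow o o))
    (hconn : PathConnected M)
    (L : AffineConnection M) (hsymm : L.IsSymmetric) (hflat : L.IsFlat) :
    (∃! E : M → M → M → M, L.IsExtension E) ∧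
    ∀ E : M → M → M → M, L.IsExtension E → ∀ o x y z : M,
      E (E x o y) o z = E (E x o y) y (E y o z) ∧
      E (E x o y) y (E y o z) = E x o (E y o z) ∧
      E (E x o y) o z = E x o (E y o z) := by
  obtain ⟨T, hT⟩ := L.exists_parallelTransport hM hconn hflat
  obtain ⟨E, hE⟩ := L.exists_seqGrid_eq hconn hsymm hT
  have hiff := L.isExtension_iff hconn hE
  refine ⟨⟨E, (hiff E).2 rfl, fun E' h => (hiff E').1 h⟩, fun E' h o x y z => ?_⟩
  rw [(hiff E').1 h]
  obtain ⟨h1, h2⟩ := L.cancellation hconn hsymm hT hE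
  -- The first law is used at `w = [x o y]`, the second at `t = [y o z]`.
  exact ⟨(h1 _ _ _ _).symm, h2 _ _ _ _, (h1 _ _ _ _).symm.trans (h2 _ _ _ _)⟩
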